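/- There is an absolute constant $c>0$ such that the following holds. Let $d\ge 0$ and $n\ge1$ be integers, let $K\in\mathbb{R}^{d\times d}$ be symmetric positive definite with $K\succeq I$, let $0\le\rho<1$, and let $f^\star:\mathbb{R}^d\to\mathbb{R}^d$ be a (Borel measurable) map that is $(K,\rho)$-globally exponentially stable, i.e. $\|f^\star(x)\|_K^2\le\rho\,\|x\|_K^2$ for all $x\in\mathbb{R}^d$, where $\|x\|_K=\sqrt{\langle x,Kx\rangle}$. Let $\varepsilon_0,\dots,\varepsilon_{n-1}$ be independent random vectors in $\mathbb{R}^d$ on a probability space, each isotropic ($\mathbb{E}[\varepsilon_t]=0$ and $\mathbb{E}[\varepsilon_t\varepsilon_t^{\top}]=I$) and subgaussian with variance proxy $\tau^2$, i.e. centred with $$\sup_{\|\theta\|=1}\ \sup_{p\ge1}\ p^{-1/2}\big(\mathbb{E}|\langle\varepsilon_t,\theta\rangle|^p\big)^{1/p}\le\tau .$$ Let $x_0=0$ and $x_{t+1}=f^\star(x_t)+\varepsilon_t$ for $0\le t<n$, and put $R_{K,\rho}=\operatorname{tr}(K)/(1-\rho)$. Then for every $\delta>0$, if $$n\ \ge\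 c\,d\,\frac{\tau^4}{(1-\rho)^2}\,\log\!\Big(\frac{R_{K,\rho}}{\delta}+1\Big),$$ then with probability at least $1-\delta$, $$\tfrac14 I\ \preceq\ \frac1n\sum_{i=1}^n x_ix_i^{\top}\ \preceq\ 4R_{K,\rho}\,I .$$ -/

import Mathlib

open MeasureTheory ProbabilityTheory
open scoped ENNReal MatrixOrder Matrix

noncomputable section

namespace NoisySystem

/-- The weighted norm `‖x‖_K = √⟨x, K x⟩`. -/
def normK {d : ℕ} (K : Matrix (Fin d) (Fin d) ℝ) (x : EuclideanSpace ℝ (Fin d)) : ℝ :=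
  √(x.ofLp ⬝ᵥ (K *ᵥ x.ofLp))

/-- The map `f` is `(K, ρ)`-globally exponentially stable: `K ≻ 0`, `0 ≤ ρ < 1` and
`‖f x‖_K² ≤ ρ ‖x‖_K²` for all `x`. -/
structure IsGES {d : ℕ} (K : Matrix (Fin d) (Fin d) ℝ) (ρ : ℝ)
    (f : EuclideanSpace ℝ (Fin d) → EuclideanSpace ℝ (Fin d)) : Prop where
  posDef : K.PosDef
  rho_nonneg : 0 ≤ ρ
  rho_lt_one : ρ < 1
  contract : ∀ x, normK K (f x) ^ 2 ≤ ρ * normK K x ^ 2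

/-- The subgaussian norm
`sup_{‖θ‖ = 1} sup_{p ≥ 1} p^{-1/2} (𝔼 |⟨v, θ⟩|^p)^{1/p}`, with values in `[0, ∞]`. -/
def subgaussianNorm {Ω : Type*} [MeasurableSpace Ω] {d : ℕ}
    (v : Ω → EuclideanSpace ℝ (Fin d)) (μ : Measure Ω) : ℝ≥0∞ :=
  ⨆ (θ : EuclideanSpace ℝ (Fin d)) (_ : ‖θ‖ = 1) (p : ℝ) (_ : 1 ≤ p),
    ENNReal.ofReal (p ^ (-(1 / 2) : ℝ)) *
      eLpNorm (fun ω => inner ℝ (v ω) θ) (ENNReal.ofReal p) μ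

/-- The random vector `v` is subgaussian with variance proxy `τ²`: it is centred and its
subgaussian norm is at most `τ`. -/
structure IsSubG {Ω : Type*} [MeasurableSpace Ω] {d : ℕ}
    (v : Ω → EuclideanSpace ℝ (Fin d)) (τ : ℝ) (μ : Measure Ω) : Prop where
  mean_zero : ∫ ω, v ω ∂μ = 0
  norm_le : subgaussianNorm v μ ≤ ENNReal.ofReal τ

/-- The random vector `v` is isotropic: zero mean and `𝔼[v vᵀ] = I`, entry by entry
(each entry being an integrable random variable). -/
structure IsIsotropic {Ω : Type*} [MeasurableSpace Ω] {d : ℕ}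
    (v : Ω → EuclideanSpace ℝ (Fin d)) (μ : Measure Ω) : Prop where
  integrable : Integrable v μ
  mean_zero : ∫ ω, v ω ∂μ = 0
  integrable_mul : ∀ i j, Integrable (fun ω => v ω i * v ω j) μ
  cov : ∀ i j, ∫ ω, v ω i * v ω j ∂μ = (1 : Matrix (Fin d) (Fin d) ℝ) i j

/-- The noise vectors `ε 0, …, ε (n - 1)` are random vectors that are independent, isotropic and
subgaussian with variance proxy `τ²`. -/
structure IsNoise {Ω : Type*} [MeasurableSpace Ω] {d : ℕ} (n : ℕ)
    (ε : ℕ → Ω → EuclideanSpace ℝ (Fin d)) (τ : ℝ) (μ : Measure Ω) : Prop where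
  measurable : ∀ t < n, Measurable (ε t)
  indep : iIndepFun (fun t : Fin n => ε t) μ
  isotropic : ∀ t < n, IsIsotropic (ε t) μ
  subG : ∀ t < n, IsSubG (ε t) τ μ

/-- The trajectory `x_{t+1} = f (x_t) + e_t` started from `x_0 = 0`. -/
def trajectory {d : ℕ} (f : EuclideanSpace ℝ (Fin d) → EuclideanSpace ℝ (Fin d))
    (e : ℕ → EuclideanSpace ℝ (Fin d)) : ℕ → EuclideanSpace ℝ (Fin d)
  | 0 => 0
  | t + 1 => f (trajectory f e t) + e t

/-- The empirical covariance `(1/n) ∑_{i=1}^n x_i x_iᵀ`. -/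
def empiricalCov {d : ℕ} (n : ℕ) (x : ℕ → EuclideanSpace ℝ (Fin d)) :
    Matrix (Fin d) (Fin d) ℝ :=
  (1 / (n : ℝ)) • ∑ i ∈ Finset.Icc 1 n, Matrix.vecMulVec (x i).ofLp (x i).ofLp

/-- The effective radius `R_{K,ρ} = tr K / (1 - ρ)`. -/
def effectiveRadius {d : ℕ} (K : Matrix (Fin d) (Fin d) ℝ) (ρ : ℝ) : ℝ :=
  K.trace / (1 - ρ)

end NoisySystem

end

namespace NoisySystem

/-! ### Exponential moments of a standardised scalar subgaussian variable -/

section Scalar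

variable {Ω : Type*} [MeasurableSpace Ω] {μ : Measure Ω}

/-! Everything rests on one-step bounds `𝔼 exp (G x ε_t) ≤ 1`, valid for every frozen state `x`. As
`ε_t` is independent of `x_t`, these factors multiply along the trajectory to a product of mean at
most one (`lintegral_prod_trajectory_le_one`, a supermartingale argument), and Markov's inequality
controls the sum of the `G`. No mixing is needed.

Upper bound: writing `K = ∑ b_j b_jᵀ`, `G` compares `‖f x + ε‖_K²` with `3/2 tr K` plus slightly
more than `‖f x‖_K²`. The contraction gap `1 - ρ` absorbs the excess, so summation bounds `∑
‖x_i‖_K²`, hence `∑ ‖x_i‖²`, by `4nR`; this total energy dominates every direction at once.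

Lower bound: along a unit vector `θ` the noise injects variance one whatever the drift, so `G = -l
(⟨f x + ε, θ⟩² - 3/4)` is admissible. Thus `∑ ⟨x_i, θ⟩² ≥ n/2` outside an event of probability `exp
(-n / (768 τ⁴))`. A union bound over a grid of mesh about `1/(20R)`, with the energy bound to pass
to nearby directions, gives all `θ`. The grid has `O(R)^d` points, whence the term `d log (R/δ +
1)`. -/

lemma lintegral_ofReal_le_of_le {f g : Ω → ℝ} (hf : ∀ ω, 0 ≤ f ω) (hfg : ∀ ω, f ω ≤ g ω)
    (hg : Integrable g μ) {c : ℝ} (hc : ∫ ω, g ω ∂μ ≤ c) :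
    ∫⁻ ω, ENNReal.ofReal (f ω) ∂μ ≤ ENNReal.ofReal c := by
  calc ∫⁻ ω, ENNReal.ofReal (f ω) ∂μ ≤ ∫⁻ ω, ENNReal.ofReal (g ω) ∂μ :=
        lintegral_mono fun ω => ENNReal.ofReal_le_ofReal (hfg ω)
    _ = ENNReal.ofReal (∫ ω, g ω ∂μ) :=
        (ofReal_integral_eq_lintegral_ofReal hg (.of_forall fun ω => (hf ω).trans (hfg ω))).symm
    _ ≤ ENNReal.ofReal c := ENNReal.ofReal_le_ofReal hc

lemma integral_add_add {f g h : Ω → ℝ} (hf : Integrable f μ) (hg : Integrable g μ)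
    (hh : Integrable h μ) : ∫ ω, f ω + (g ω + h ω) ∂μ =
      ∫ ω, f ω ∂μ + (∫ ω, g ω ∂μ + ∫ ω, h ω ∂μ) := by
  rw [← integral_add hg hh]
  exact integral_add hf (hg.add hh)

/-- The linear term integrates to zero for centred variables, which leaves only an exponential of a
square. -/
lemma exp_le_add_exp_sq (x : ℝ) : Real.exp x ≤ x + Real.exp (x ^ 2) := by
  have h1 := Real.add_one_le_exp (x ^ 2)
  rcases le_or_gt |x| 1 with h | h
  · have := abs_le.1 (Real.abs_exp_sub_one_sub_id_le h)
    linarith [this.2]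
  · rcases lt_abs.1 h with h | h
    · have : Real.exp x ≤ Real.exp (x ^ 2) := Real.exp_le_exp.2 (by nlinarith)
      linarith
    · have : Real.exp x ≤ 1 := Real.exp_le_one_iff.2 (by linarith)
      nlinarith

lemma exp_mul_le_interp {t : ℝ} (h0 : 0 ≤ t) (h1 : t ≤ 1) (z : ℝ) :
    Real.exp (t * z) ≤ 1 - t + t * Real.exp z := by
  have := convexOn_exp.2 (Set.mem_univ (0 : ℝ)) (Set.mem_univ z) (sub_nonneg.2 h1) h0 (by ring)
  simpa using this

lemma exp_neg_le_quadratic {x : ℝ} (hx : 0 ≤ x) : Real.exp (-x) ≤ 1 - x + x ^ 2 / 2 := by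
  have h := Real.quadratic_le_exp_of_nonneg hx
  have h2 : 1 ≤ (1 + x + x ^ 2 / 2) * (1 - x + x ^ 2 / 2) := by
    have : (1 + x + x ^ 2 / 2) * (1 - x + x ^ 2 / 2) = 1 + x ^ 4 / 4 := by ring
    rw [this]; nlinarith [sq_nonneg (x ^ 2)]
  have h3 : 0 ≤ 1 - x + x ^ 2 / 2 := by nlinarith [sq_nonneg (x - 1)]
  rw [Real.exp_neg, inv_le_iff_one_le_mul₀ (Real.exp_pos x)]
  nlinarith

/-- A second-order bound for the exponential, with remainder controlled at a larger exponent. -/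
lemma exp_mul_le_second_order {r z : ℝ} (hr0 : 0 ≤ r) (hr : r ≤ 1 / 2) (hz : 0 ≤ z) :
    Real.exp (r * z) ≤ 1 + r * z + 8 * r ^ 2 * Real.exp z := by
  have hx0 : 0 ≤ r * z := mul_nonneg hr0 hz
  have h1 : Real.exp (r * z) ≤ 1 + r * z + (r * z) ^ 2 * Real.exp (r * z) := by
    have he : Real.exp (r * z) * Real.exp (-(r * z)) = 1 := by rw [← Real.exp_add]; simp
    have h6 : Real.exp (r * z) * (1 - r * z) ≤ 1 := by
      calc Real.exp (r * z) * (1 - r * z) ≤ Real.exp (r * z) * Real.exp (-(r * z)) := by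
            gcongr; linarith [Real.add_one_le_exp (-(r * z))]
        _ = 1 := he
    nlinarith
  have h2 : z ^ 2 / 8 ≤ Real.exp (z / 2) := by
    have := Real.quadratic_le_exp_of_nonneg (by positivity : 0 ≤ z / 2)
    nlinarith
  have h3 : Real.exp (r * z) ≤ Real.exp (z / 2) := Real.exp_le_exp.2 (by nlinarith)
  have h4 : Real.exp (z / 2) * Real.exp (z / 2) = Real.exp z := by rw [← Real.exp_add]; ring_nf
  calc Real.exp (r * z) ≤ 1 + r * z + (r * z) ^ 2 * Real.exp (r * z) := h1
    _ = 1 + r * z + 8 * r ^ 2 * (z ^ 2 / 8 * Real.exp (r * z)) := by ring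
    _ ≤ 1 + r * z + 8 * r ^ 2 * (Real.exp (z / 2) * Real.exp (z / 2)) := by gcongr
    _ = _ := by rw [h4]

/-- Standardised real random variables whose even moments grow as those of a Gaussian of
variance `τ²`. -/
structure IsStdSubG (ξ : Ω → ℝ) (τ : ℝ) (μ : Measure Ω) : Prop where
  measurable : Measurable ξ
  integrable : Integrable ξ μ
  integral_eq_zero : ∫ ω, ξ ω ∂μ = 0
  integrable_sq : Integrable (fun ω => ξ ω ^ 2) μ
  integral_sq : ∫ ω, ξ ω ^ 2 ∂μ = 1
  moment_le : ∀ k : ℕ, 1 ≤ k →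
    ∫⁻ ω, ENNReal.ofReal (ξ ω ^ (2 * k)) ∂μ ≤ ENNReal.ofReal ((2 * k * τ ^ 2) ^ k)

lemma pow_self_le_factorial_mul_exp (k : ℕ) :
    (k : ℝ) ^ k ≤ k.factorial * Real.exp 1 ^ k := by
  have h := Real.pow_div_factorial_le_exp (k : ℝ) (Nat.cast_nonneg k) k
  rw [div_le_iff₀ (by positivity)] at h
  rw [← Real.exp_nat_mul, mul_one, mul_comm]
  exact h

variable [IsProbabilityMeasure μ] {ξ : Ω → ℝ} {τ : ℝ}

namespace IsStdSubG

omit [IsProbabilityMeasure μ] in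
-- Unit variance against the second-moment bound `2τ²`. It is used throughout to trade `τ²` for
-- `2τ⁴`.
lemma half_le_sq (h : IsStdSubG ξ τ μ) : 1 / 2 ≤ τ ^ 2 := by
  have h1 := h.moment_le 1 le_rfl
  rw [← ofReal_integral_eq_lintegral_ofReal (by simpa using h.integrable_sq)
    (.of_forall fun ω => (even_two_mul 1).pow_nonneg _)] at h1
  simp only [mul_one, h.integral_sq] at h1
  rw [ENNReal.ofReal_le_ofReal_iff (by positivity)] at h1
  norm_num at h1
  linarith

omit [IsProbabilityMeasure μ] in
lemma ne_zero (h : IsStdSubG ξ τ μ) : τ ≠ 0 := by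
  rintro rfl
  have := h.half_le_sq
  norm_num at this

/-- Taylor expansion: the `k`-th term is at most `(k/6)^k / k! ≤ (e/6)^k ≤ 2^{-k}`. -/
lemma lintegral_exp_sq (h : IsStdSubG ξ τ μ) :
    ∫⁻ ω, ENNReal.ofReal (Real.exp (1 / (12 * τ ^ 2) * ξ ω ^ 2)) ∂μ ≤ 2 := by
  have hτ := h.half_le_sq
  have hm := h.measurable
  have hexp : ∀ ω, ENNReal.ofReal (Real.exp (1 / (12 * τ ^ 2) * ξ ω ^ 2)) =
      ∑' k : ℕ, ENNReal.ofReal ((1 / (12 * τ ^ 2)) ^ k / k.factorial * ξ ω ^ (2 * k)) := by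
    intro ω
    have hs := NormedSpace.expSeries_div_hasSum_exp (1 / (12 * τ ^ 2) * ξ ω ^ 2)
    rw [← Real.exp_eq_exp_ℝ] at hs
    rw [← hs.tsum_eq, ENNReal.ofReal_tsum_of_nonneg (fun k => by positivity) hs.summable]
    congr 1 with k
    congr 1
    rw [mul_pow, pow_mul]
    ring
  have hterm : ∀ k : ℕ, ∫⁻ ω, ENNReal.ofReal ((1 / (12 * τ ^ 2)) ^ k / k.factorial *
      ξ ω ^ (2 * k)) ∂μ ≤ ENNReal.ofReal ((1 / 2) ^ k) := by
    intro k
    rcases Nat.eq_zero_or_pos k with rfl | hk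
    · simp
    have hc : 0 ≤ (1 / (12 * τ ^ 2)) ^ k / (k.factorial : ℝ) := by positivity
    simp_rw [ENNReal.ofReal_mul hc]
    rw [lintegral_const_mul _ (by fun_prop)]
    refine (mul_le_mul_right (h.moment_le k hk) _).trans ?_
    rw [← ENNReal.ofReal_mul hc]
    refine ENNReal.ofReal_le_ofReal ?_
    have he := Real.exp_one_lt_d9
    calc (1 / (12 * τ ^ 2)) ^ k / (k.factorial : ℝ) * (2 * k * τ ^ 2) ^ k
        = (1 / 6) ^ k * ((k : ℝ) ^ k / k.factorial) := by
          rw [div_mul_eq_mul_div, ← mul_pow, mul_div_assoc', ← mul_pow]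
          congr 2
          have := h.ne_zero
          field_simp
          norm_num
      _ ≤ (1 / 6) ^ k * Real.exp 1 ^ k := by
          gcongr
          rw [div_le_iff₀ (by positivity), mul_comm]
          exact pow_self_le_factorial_mul_exp k
      _ = (1 / 6 * Real.exp 1) ^ k := by rw [mul_pow]
      _ ≤ (1 / 2) ^ k := by gcongr; linarith
  simp_rw [hexp]
  rw [lintegral_tsum fun k => by fun_prop]
  refine (ENNReal.tsum_le_tsum hterm).trans ?_
  rw [← ENNReal.ofReal_tsum_of_nonneg (fun k => by positivity) summable_geometric_two,
    tsum_geometric_two]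
  simp

lemma integrable_exp_sq (h : IsStdSubG ξ τ μ) :
    Integrable (fun ω => Real.exp (1 / (12 * τ ^ 2) * ξ ω ^ 2)) μ := by
  have hm := h.measurable
  refine ⟨by fun_prop, ?_⟩
  rw [hasFiniteIntegral_iff_ofReal (.of_forall fun ω => by positivity)]
  exact h.lintegral_exp_sq.trans_lt (by simp)

lemma integral_exp_sq (h : IsStdSubG ξ τ μ) :
    ∫ ω, Real.exp (1 / (12 * τ ^ 2) * ξ ω ^ 2) ∂μ ≤ 2 := by
  have h1 := h.lintegral_exp_sq
  rw [← ofReal_integral_eq_lintegral_ofReal h.integrable_exp_sq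
    (.of_forall fun ω => by positivity)] at h1
  rw [← ENNReal.ofReal_ofNat 2] at h1
  exact (ENNReal.ofReal_le_ofReal_iff (by norm_num)).1 h1

/-- Moment generating function bound. -/
lemma lintegral_exp_linear (h : IsStdSubG ξ τ μ) (a : ℝ) :
    ∫⁻ ω, ENNReal.ofReal (Real.exp (a * ξ ω - 12 * τ ^ 2 * a ^ 2)) ∂μ ≤ 1 := by
  have hτ := h.half_le_sq
  set t := 12 * τ ^ 2 * a ^ 2 with ht
  have ht0 : 0 ≤ t := by positivity
  have hE := h.integral_exp_sq
  rw [← ENNReal.ofReal_one]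
  rcases le_or_gt t 1 with h1 | h1
  -- For `t ≤ 1`, `(aξ)²` is `t` times the exponent of `integral_exp_sq`, so convexity gives mean at
  -- most `1 + t ≤ exp t`.
  · refine lintegral_ofReal_le_of_le (g := fun ω => Real.exp (-t) * (a * ξ ω + (1 - t +
      t * Real.exp (1 / (12 * τ ^ 2) * ξ ω ^ 2)))) (fun ω => by positivity) (fun ω => ?_) ?_ ?_
    · rw [sub_eq_neg_add, Real.exp_add]
      gcongr
      refine (exp_le_add_exp_sq _).trans ?_
      gcongr
      refine le_trans (le_of_eq ?_) (exp_mul_le_interp ht0 h1 _)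
      congr 1
      have := h.ne_zero
      rw [ht]; field_simp
    · exact ((h.integrable.const_mul a).add ((integrable_const _).add
        (h.integrable_exp_sq.const_mul t))).const_mul _
    · rw [integral_const_mul, integral_add_add (h.integrable.const_mul a)
        (integrable_const _) (h.integrable_exp_sq.const_mul t),
        integral_const_mul, integral_const_mul, h.integral_eq_zero]
      have he : Real.exp (-t) * Real.exp t = 1 := by rw [← Real.exp_add]; simp
      refine le_trans (mul_le_mul_of_nonneg_left ?_ (Real.exp_pos _).le) he.le
      rw [integral_const, probReal_univ, one_smul]
      nlinarith [Real.add_one_le_exp t]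
  -- For `t > 1`, Young's inequality suffices: the factor 2 is beaten by `exp (-3t/4)`.
  · refine lintegral_ofReal_le_of_le (g := fun ω => Real.exp (t / 4 - t) *
      Real.exp (1 / (12 * τ ^ 2) * ξ ω ^ 2)) (fun ω => by positivity) (fun ω => ?_) ?_ ?_
    · rw [← Real.exp_add]
      gcongr
      have h2 : a * ξ ω = t / 4 + 1 / (12 * τ ^ 2) * ξ ω ^ 2 -
          1 / (12 * τ ^ 2) * (ξ ω - 6 * τ ^ 2 * a) ^ 2 := by
        have := h.ne_zero
        rw [ht]; field_simp; ring
      have h3 : 0 ≤ 1 / (12 * τ ^ 2) * (ξ ω - 6 * τ ^ 2 * a) ^ 2 := by positivity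
      linarith
    · exact h.integrable_exp_sq.const_mul _
    · rw [integral_const_mul]
      have h4 : 2 * Real.exp (t / 4 - t) ≤ 1 := by
        have h5 : Real.exp (t / 4 - t) ≤ Real.exp (-Real.log 2) :=
          Real.exp_le_exp.2 (by linarith [Real.log_two_lt_d9])
        rw [Real.exp_neg, Real.exp_log (by norm_num)] at h5
        linarith
      nlinarith [Real.exp_pos (t / 4 - t)]

/-- The mean `1` enters with its exact first-order coefficient; the slack `3/2 - 1` pays for the
second-order remainder `16 r² ≤ u/2`, which is what the constant 4608 ensures. -/
lemma lintegral_exp_sq_le (h : IsStdSubG ξ τ μ) {u : ℝ} (hu0 : 0 ≤ u)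
    (hu : u * (4608 * τ ^ 4) ≤ 1) :
    ∫⁻ ω, ENNReal.ofReal (Real.exp (u * (ξ ω ^ 2 - 3 / 2))) ∂μ ≤ 1 := by
  have hτ := h.half_le_sq
  have hE := h.integral_exp_sq
  have hne := h.ne_zero
  set r := u * (12 * τ ^ 2) with hr
  have hr0 : 0 ≤ r := by positivity
  have hr1 : r ≤ 1 / 2 := by
    have : u * τ ^ 2 * (1 / 2) ≤ u * τ ^ 2 * τ ^ 2 := by gcongr
    nlinarith
  rw [← ENNReal.ofReal_one]
  refine lintegral_ofReal_le_of_le (g := fun ω => Real.exp (-(3 / 2 * u)) * (1 + (u * ξ ω ^ 2 +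
      8 * r ^ 2 * Real.exp (1 / (12 * τ ^ 2) * ξ ω ^ 2)))) (fun ω => by positivity)
      (fun ω => ?_) ?_ ?_
  · rw [show u * (ξ ω ^ 2 - 3 / 2) = -(3 / 2 * u) + u * ξ ω ^ 2 by ring, Real.exp_add]
    gcongr
    have := exp_mul_le_second_order hr0 hr1 (z := 1 / (12 * τ ^ 2) * ξ ω ^ 2) (by positivity)
    have h2 : r * (1 / (12 * τ ^ 2) * ξ ω ^ 2) = u * ξ ω ^ 2 := by rw [hr]; field_simp
    rw [h2] at this
    linarith
  · exact ((integrable_const _).add ((h.integrable_sq.const_mul u).add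
        (h.integrable_exp_sq.const_mul _))).const_mul _
  · rw [integral_const_mul, integral_add_add (integrable_const _) (h.integrable_sq.const_mul u)
        (h.integrable_exp_sq.const_mul _),
        integral_const_mul, integral_const_mul, h.integral_sq]
    have he : Real.exp (-(3 / 2 * u)) * Real.exp (3 / 2 * u) = 1 := by rw [← Real.exp_add]; simp
    refine le_trans (mul_le_mul_of_nonneg_left ?_ (Real.exp_pos _).le) he.le
    rw [integral_const, probReal_univ, one_smul]
    have h3 : r ^ 2 * ∫ ω, Real.exp (1 / (12 * τ ^ 2) * ξ ω ^ 2) ∂μ ≤ r ^ 2 * 2 := by gcongr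
    have h4 : 16 * r ^ 2 ≤ u / 2 := by
      have : 16 * r ^ 2 = u * (u * (4608 * τ ^ 4)) / 2 := by rw [hr]; ring
      rw [this]; nlinarith
    nlinarith [Real.add_one_le_exp (3 / 2 * u)]

/-- Lower tails of a nonnegative variable need only the fourth moment `16τ⁴`; the slack `1 - 3/4`
pays for the quadratic term. -/
lemma lintegral_exp_neg_sq_le (h : IsStdSubG ξ τ μ) {u : ℝ} (hu0 : 0 ≤ u)
    (hu : u * (32 * τ ^ 4) ≤ 1) :
    ∫⁻ ω, ENNReal.ofReal (Real.exp (-(u * (ξ ω ^ 2 - 3 / 4)))) ∂μ ≤ 1 := by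
  have hm4 := h.moment_le 2 (by norm_num)
  have hint : Integrable (fun ω => ξ ω ^ 4) μ := by
    have hm := h.measurable
    refine ⟨by fun_prop, ?_⟩
    rw [hasFiniteIntegral_iff_ofReal (.of_forall fun ω => by positivity)]
    exact hm4.trans_lt (by simp)
  have h4 : ∫ ω, ξ ω ^ 4 ∂μ ≤ 16 * τ ^ 4 := by
    rw [← ofReal_integral_eq_lintegral_ofReal (by simpa using hint)
      (.of_forall fun ω => (even_two_mul 2).pow_nonneg _)] at hm4
    have := (ENNReal.ofReal_le_ofReal_iff (by positivity)).1 hm4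
    norm_num at this
    linarith
  rw [← ENNReal.ofReal_one]
  refine lintegral_ofReal_le_of_le (g := fun ω => Real.exp (3 / 4 * u) * (1 + (-u * ξ ω ^ 2 +
      u ^ 2 / 2 * ξ ω ^ 4))) (fun ω => by positivity)
      (fun ω => ?_) ?_ ?_
  · rw [show -(u * (ξ ω ^ 2 - 3 / 4)) = (3 / 4 * u) + -(u * ξ ω ^ 2) by ring, Real.exp_add]
    gcongr
    have := exp_neg_le_quadratic (x := u * ξ ω ^ 2) (by positivity)
    nlinarith
  · exact ((integrable_const _).add ((h.integrable_sq.const_mul (-u)).add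
        (hint.const_mul _))).const_mul _
  · rw [integral_const_mul, integral_add_add (integrable_const _) (h.integrable_sq.const_mul (-u))
        (hint.const_mul _), integral_const_mul, integral_const_mul, h.integral_sq]
    have he : Real.exp (3 / 4 * u) * Real.exp (-(3 / 4 * u)) = 1 := by rw [← Real.exp_add]; simp
    refine le_trans (mul_le_mul_of_nonneg_left ?_ (Real.exp_pos _).le) he.le
    rw [integral_const, probReal_univ, one_smul]
    have h3 : u ^ 2 / 2 * ∫ ω, ξ ω ^ 4 ∂μ ≤ u ^ 2 / 2 * (16 * τ ^ 4) := by gcongr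
    have h5 : u ^ 2 / 2 * (16 * τ ^ 4) ≤ u / 4 := by
      have : u ^ 2 / 2 * (16 * τ ^ 4) = u * (u * (32 * τ ^ 4)) / 4 := by ring
      rw [this]; nlinarith
    linarith [Real.add_one_le_exp (-(3 / 4 * u))]

end IsStdSubG

end Scalar
end NoisySystem

namespace NoisySystem

/-! ### One-step exponential bounds for the noise vectors -/

section Vector

variable {Ω : Type*} [MeasurableSpace Ω] {μ : Measure Ω} {d : ℕ}
  {v : Ω → EuclideanSpace ℝ (Fin d)} {τ : ℝ}

lemma inner_sq_eq_sum (x θ : EuclideanSpace ℝ (Fin d)) :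
    inner ℝ x θ ^ 2 = ∑ i, ∑ j, θ i * θ j * (x i * x j) := by
  rw [PiLp.inner_apply, sq, Finset.sum_mul_sum]
  refine Finset.sum_congr rfl fun i _ => Finset.sum_congr rfl fun j _ => ?_
  simp
  ring

lemma IsSubG.lintegral_inner_pow_le (hv : IsSubG v τ μ) {θ : EuclideanSpace ℝ (Fin d)}
    (hθ : ‖θ‖ = 1) {k : ℕ} (hk : 1 ≤ k) :
    ∫⁻ ω, ENNReal.ofReal (inner ℝ (v ω) θ ^ (2 * k)) ∂μ ≤
      ENNReal.ofReal ((2 * k * τ ^ 2) ^ k) := by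
  have hk' : (1 : ℝ) ≤ k := by exact_mod_cast hk
  have hp : (1 : ℝ) ≤ ((2 * k : ℕ) : ℝ) := by push_cast; linarith
  have hp0 : (0 : ℝ) < ((2 * k : ℕ) : ℝ) := by linarith
  set p : ℝ := ((2 * k : ℕ) : ℝ) with hpdef
  have h1 : ENNReal.ofReal (p ^ (-(1 / 2) : ℝ)) *
      eLpNorm (fun ω => inner ℝ (v ω) θ) (ENNReal.ofReal p) μ ≤ ENNReal.ofReal τ := by
    refine le_trans ?_ hv.norm_le
    unfold subgaussianNorm
    refine le_iSup_of_le θ <| le_iSup_of_le hθ <| le_iSup_of_le p <| le_iSup_of_le hp le_rfl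
  have h2 : eLpNorm (fun ω => inner ℝ (v ω) θ) (ENNReal.ofReal p) μ ≤
      ENNReal.ofReal (p ^ (1 / 2 : ℝ) * |τ|) := by
    have h3 : ENNReal.ofReal (p ^ (1 / 2 : ℝ)) * ENNReal.ofReal (p ^ (-(1 / 2) : ℝ)) = 1 := by
      rw [← ENNReal.ofReal_mul (by positivity), ← Real.rpow_add hp0]
      simp
    calc eLpNorm (fun ω => inner ℝ (v ω) θ) (ENNReal.ofReal p) μ
        = ENNReal.ofReal (p ^ (1 / 2 : ℝ)) * (ENNReal.ofReal (p ^ (-(1 / 2) : ℝ)) *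
          eLpNorm (fun ω => inner ℝ (v ω) θ) (ENNReal.ofReal p) μ) := by
          rw [← mul_assoc, h3, one_mul]
      _ ≤ ENNReal.ofReal (p ^ (1 / 2 : ℝ)) * ENNReal.ofReal |τ| := by
          gcongr; exact h1.trans (ENNReal.ofReal_le_ofReal (le_abs_self τ))
      _ = _ := by rw [← ENNReal.ofReal_mul (by positivity)]
  rw [eLpNorm_eq_lintegral_rpow_enorm_toReal (by simpa using hp0) (by simp),
    ENNReal.toReal_ofReal hp0.le, one_div, ENNReal.rpow_inv_le_iff hp0] at h2
  calc ∫⁻ ω, ENNReal.ofReal (inner ℝ (v ω) θ ^ (2 * k)) ∂μ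
      = ∫⁻ ω, ‖inner ℝ (v ω) θ‖ₑ ^ p ∂μ := by
        refine lintegral_congr fun ω => ?_
        rw [hpdef, ENNReal.rpow_natCast, Real.enorm_eq_ofReal_abs,
          ← ENNReal.ofReal_pow (abs_nonneg _), (even_two_mul k).pow_abs]
    _ ≤ _ := h2
    _ = _ := by
        rw [hpdef, ENNReal.rpow_natCast, ← ENNReal.ofReal_pow (by positivity), ← hpdef]
        congr 1
        rw [mul_pow, (even_two_mul k).pow_abs, pow_mul, pow_mul, ← mul_pow, ← Real.sqrt_eq_rpow,
          Real.sq_sqrt hp0.le, hpdef]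
        push_cast
        rfl

lemma isStdSubG_inner (hm : Measurable v) (hi : IsIsotropic v μ) (hv : IsSubG v τ μ)
    {θ : EuclideanSpace ℝ (Fin d)} (hθ : ‖θ‖ = 1) :
    IsStdSubG (fun ω => inner ℝ (v ω) θ) τ μ where
  measurable := by fun_prop
  integrable := hi.integrable.inner_const θ
  integral_eq_zero := by
    simp_rw [real_inner_comm θ]
    rw [integral_inner hi.integrable, hi.mean_zero, inner_zero_right]
  integrable_sq := by
    simp_rw [inner_sq_eq_sum]
    exact integrable_finsetSum _ fun i _ => integrable_finsetSum _ fun j _ =>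
      (hi.integrable_mul i j).const_mul _
  integral_sq := by
    simp_rw [inner_sq_eq_sum]
    rw [integral_finsetSum _ fun i _ => integrable_finsetSum _ fun j _ =>
      (hi.integrable_mul i j).const_mul _]
    have h1 : ∀ i, ∫ ω, ∑ j, θ i * θ j * (v ω i * v ω j) ∂μ = θ i ^ 2 := by
      intro i
      rw [integral_finsetSum _ fun j _ => (hi.integrable_mul i j).const_mul _]
      simp_rw [integral_const_mul, hi.cov, Matrix.one_apply]
      simp [sq]
    simp_rw [h1]
    rw [← EuclideanSpace.real_norm_sq_eq, hθ, one_pow]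
  moment_le k hk := hv.lintegral_inner_pow_le hθ hk

/-- Jensen's inequality for `exp`, so no independence between the `F i` is needed. Zero weights are
exempt because they arise from zero vectors, which have no direction. -/
lemma lintegral_exp_sum_le_one {ι : Type*} {s : Finset ι} {w : ι → ℝ} {F : ι → Ω → ℝ}
    (hw : ∀ i ∈ s, 0 ≤ w i) (hw1 : ∑ i ∈ s, w i = 1) (hF : ∀ i ∈ s, Measurable (F i))
    (h : ∀ i ∈ s, 0 < w i → ∫⁻ ω, ENNReal.ofReal (Real.exp (F i ω)) ∂μ ≤ 1) :
    ∫⁻ ω, ENNReal.ofReal (Real.exp (∑ i ∈ s, w i * F i ω)) ∂μ ≤ 1 := by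
  calc ∫⁻ ω, ENNReal.ofReal (Real.exp (∑ i ∈ s, w i * F i ω)) ∂μ
      ≤ ∫⁻ ω, ∑ i ∈ s, ENNReal.ofReal (w i) * ENNReal.ofReal (Real.exp (F i ω)) ∂μ := by
        refine lintegral_mono fun ω => ?_
        have := convexOn_exp.map_sum_le hw hw1 (p := fun i => F i ω) (by simp)
        simp only [smul_eq_mul] at this
        refine (ENNReal.ofReal_le_ofReal this).trans (le_of_eq ?_)
        rw [ENNReal.ofReal_sum_of_nonneg fun i hi => mul_nonneg (hw i hi) (Real.exp_pos _).le]
        exact Finset.sum_congr rfl fun i hi => ENNReal.ofReal_mul (hw i hi)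
    _ = ∑ i ∈ s, ENNReal.ofReal (w i) * ∫⁻ ω, ENNReal.ofReal (Real.exp (F i ω)) ∂μ := by
        have hF' : ∀ i ∈ s, Measurable fun ω => ENNReal.ofReal (Real.exp (F i ω)) :=
          fun i hi => (Real.measurable_exp.comp (hF i hi)).ennreal_ofReal
        rw [lintegral_finsetSum' _ fun i hi => ((hF' i hi).const_mul _).aemeasurable]
        exact Finset.sum_congr rfl fun i hi => lintegral_const_mul _ (hF' i hi)
    _ ≤ ∑ i ∈ s, ENNReal.ofReal (w i) := by
        refine Finset.sum_le_sum fun i hi => ?_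
        rcases (hw i hi).eq_or_lt with h0 | h0
        · simp [← h0]
        · exact mul_le_of_le_one_right' (h i hi h0)
    _ = 1 := by rw [← ENNReal.ofReal_sum_of_nonneg hw, hw1, ENNReal.ofReal_one]

lemma lintegral_exp_half_add_le_one {F G : Ω → ℝ} (hF : Measurable F) (hG : Measurable G)
    (h1 : ∫⁻ ω, ENNReal.ofReal (Real.exp (F ω)) ∂μ ≤ 1)
    (h2 : ∫⁻ ω, ENNReal.ofReal (Real.exp (G ω)) ∂μ ≤ 1) :
    ∫⁻ ω, ENNReal.ofReal (Real.exp ((F ω + G ω) / 2)) ∂μ ≤ 1 := by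
  have := lintegral_exp_sum_le_one (μ := μ) (s := Finset.univ) (w := fun _ : Fin 2 => 1 / 2)
    (F := ![F, G]) (by simp) (by simp) (by simp [Fin.forall_fin_two, hF, hG])
    (by simpa [Fin.forall_fin_two] using ⟨h1, h2⟩)
  refine le_trans (le_of_eq ?_) this
  simp [Fin.sum_univ_two]
  congr 1 with ω
  ring_nf

variable [IsProbabilityMeasure μ]

lemma lintegral_exp_inner_le_one (hm : Measurable v) (hi : IsIsotropic v μ) (hv : IsSubG v τ μ)
    (w : EuclideanSpace ℝ (Fin d)) :
    ∫⁻ ω, ENNReal.ofReal (Real.exp (inner ℝ (v ω) w - 12 * τ ^ 2 * ‖w‖ ^ 2)) ∂μ ≤ 1 := by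
  rcases eq_or_ne w 0 with rfl | hw
  · simp
  have h := (isStdSubG_inner hm hi hv (θ := ‖w‖⁻¹ • w) (norm_smul_inv_norm hw)).lintegral_exp_linear
    ‖w‖
  refine le_trans (le_of_eq ?_) h
  congr 1 with ω
  rw [inner_smul_right, mul_inv_cancel_left₀ (norm_ne_zero_iff.2 hw)]

/-- One-step exponential bound for the lower tail of a squared linear functional. -/
lemma lintegral_exp_neg_sq_inner_add_le_one (hm : Measurable v) (hi : IsIsotropic v μ)
    (hv : IsSubG v τ μ) {θ : EuclideanSpace ℝ (Fin d)} (hθ : ‖θ‖ = 1) {l : ℝ} (hl0 : 0 ≤ l)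
    (hl : l * (192 * τ ^ 4) ≤ 1) (y : EuclideanSpace ℝ (Fin d)) :
    ∫⁻ ω, ENNReal.ofReal (Real.exp (-(l * (inner ℝ (y + v ω) θ ^ 2 - 3 / 4)))) ∂μ ≤ 1 := by
  have hξ := isStdSubG_inner hm hi hv hθ
  have hτ := hξ.half_le_sq
  set a : ℝ := inner ℝ y θ
  -- Parameters are doubled because the two bounds are averaged. The cost `96 τ² l² a²` of the cross
  -- term is absorbed by `-l a²`.
  have h1 := hξ.lintegral_exp_linear (-(4 * l * a))
  have h2 := hξ.lintegral_exp_neg_sq_le (u := 2 * l) (by positivity) (by nlinarith)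
  refine le_trans (lintegral_mono fun ω => ENNReal.ofReal_le_ofReal (Real.exp_le_exp.2 ?_))
    (lintegral_exp_half_add_le_one (by fun_prop) (by fun_prop) h1 h2)
  rw [inner_add_left]
  have h3 : 96 * l * τ ^ 2 ≤ 1 := by
    have : l * τ ^ 2 * (1 / 2) ≤ l * τ ^ 2 * τ ^ 2 := by gcongr
    nlinarith
  have h4 : l * a ^ 2 * (96 * l * τ ^ 2) ≤ l * a ^ 2 * 1 := by gcongr
  change -(l * ((a + _) ^ 2 - 3 / 4)) ≤ _
  nlinarith

lemma norm_sum_smul_sq_le {ι : Type*} [Fintype ι] (c : ι → ℝ)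
    (b : ι → EuclideanSpace ℝ (Fin d)) :
    ‖∑ j, c j • b j‖ ^ 2 ≤ (∑ j, ‖b j‖ ^ 2) * ∑ j, c j ^ 2 := by
  calc ‖∑ j, c j • b j‖ ^ 2 ≤ (∑ j, ‖b j‖ * |c j|) ^ 2 := by
        gcongr
        refine (norm_sum_le _ _).trans (le_of_eq ?_)
        exact Finset.sum_congr rfl fun j _ => by rw [norm_smul, mul_comm, Real.norm_eq_abs]
    _ ≤ (∑ j, ‖b j‖ ^ 2) * ∑ j, |c j| ^ 2 := Finset.sum_mul_sq_le_sq_mul_sq _ _ _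
    _ = _ := by simp

lemma lintegral_exp_sum_sq_inner_le_one {ι : Type*} [Fintype ι] (hm : Measurable v)
    (hi : IsIsotropic v μ) (hv : IsSubG v τ μ) (b : ι → EuclideanSpace ℝ (Fin d)) {s : ℝ}
    (hs0 : 0 ≤ s) (hT : 0 < ∑ j, ‖b j‖ ^ 2)
    (hs : s * (∑ j, ‖b j‖ ^ 2) * (4608 * τ ^ 4) ≤ 1) :
    ∫⁻ ω, ENNReal.ofReal (Real.exp (s * (∑ j, inner ℝ (v ω) (b j) ^ 2 -
      3 / 2 * ∑ j, ‖b j‖ ^ 2))) ∂μ ≤ 1 := by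
  set T := ∑ j, ‖b j‖ ^ 2 with hTdef
  -- Weights proportional to `‖b j‖²` reduce every term to a unit direction at the same parameter
  -- `sT`.
  have h := lintegral_exp_sum_le_one (μ := μ) (s := Finset.univ) (w := fun j => ‖b j‖ ^ 2 / T)
    (F := fun j ω => s * T * (inner ℝ (v ω) (‖b j‖⁻¹ • b j) ^ 2 - 3 / 2))
    (fun j _ => by positivity) (by rw [← Finset.sum_div, div_self hT.ne'])
    (fun j _ => by fun_prop) (fun j _ hj => by
      have hb : b j ≠ 0 := by
        intro h0
        simp [h0] at hj
      exact (isStdSubG_inner hm hi hv (θ := ‖b j‖⁻¹ • b j)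
        (norm_smul_inv_norm hb)).lintegral_exp_sq_le (by positivity) hs)
  refine le_trans (le_of_eq ?_) h
  congr 1 with ω
  congr 2
  have h1 : ∀ j, ‖b j‖ ^ 2 / T * (s * T * (inner ℝ (v ω) (‖b j‖⁻¹ • b j) ^ 2 - 3 / 2)) =
      s * inner ℝ (v ω) (b j) ^ 2 - 3 / 2 * s * ‖b j‖ ^ 2 := by
    intro j
    rcases eq_or_ne (b j) 0 with h0 | h0
    · simp [h0]
    · have := norm_ne_zero_iff.2 h0
      rw [inner_smul_right]
      field_simp
  simp_rw [h1]
  rw [Finset.sum_sub_distrib, ← Finset.mul_sum, ← Finset.mul_sum, ← hTdef]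
  ring

/-- One-step exponential bound for the upper tail of the increment of a quadratic form. -/
lemma lintegral_exp_quadratic_increment_le_one {ι : Type*} [Fintype ι] (hm : Measurable v)
    (hi : IsIsotropic v μ) (hv : IsSubG v τ μ) (b : ι → EuclideanSpace ℝ (Fin d)) {s : ℝ}
    (hs0 : 0 ≤ s) (hT : 0 < ∑ j, ‖b j‖ ^ 2)
    (hs : s * (∑ j, ‖b j‖ ^ 2) * (9216 * τ ^ 4) ≤ 1) (y : EuclideanSpace ℝ (Fin d)) :
    ∫⁻ ω, ENNReal.ofReal (Real.exp (s * (∑ j, inner ℝ (y + v ω) (b j) ^ 2) -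
      (s + 96 * τ ^ 2 * s ^ 2 * ∑ j, ‖b j‖ ^ 2) * (∑ j, inner ℝ y (b j) ^ 2) -
      3 / 2 * s * ∑ j, ‖b j‖ ^ 2)) ∂μ ≤ 1 := by
  -- The cross term is `2⟨v, w⟩`; Cauchy–Schwarz bounds `‖w‖²` by the trace times the energy of `y`,
  -- so its cost is a small multiple of that energy.
  set w : EuclideanSpace ℝ (Fin d) := ∑ j, inner ℝ y (b j) • b j with hw
  have h1 := lintegral_exp_inner_le_one hm hi hv ((4 * s) • w)
  have h2 := lintegral_exp_sum_sq_inner_le_one hm hi hv b (s := 2 * s) (by positivity) hT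
    (by linarith)
  refine le_trans (lintegral_mono fun ω => ENNReal.ofReal_le_ofReal (Real.exp_le_exp.2 ?_))
    (lintegral_exp_half_add_le_one (by fun_prop) (by fun_prop) h1 h2)
  have h3 := norm_sum_smul_sq_le (fun j => inner ℝ y (b j)) b
  rw [← hw] at h3
  have h4 : inner ℝ (v ω) w = ∑ j, inner ℝ y (b j) * inner ℝ (v ω) (b j) := by
    rw [hw, inner_sum]
    exact Finset.sum_congr rfl fun j _ => inner_smul_right _ _ _
  have h5 : ∑ j, inner ℝ (y + v ω) (b j) ^ 2 = ∑ j, inner ℝ y (b j) ^ 2 +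
      2 * inner ℝ (v ω) w + ∑ j, inner ℝ (v ω) (b j) ^ 2 := by
    rw [h4, Finset.mul_sum, ← Finset.sum_add_distrib, ← Finset.sum_add_distrib]
    refine Finset.sum_congr rfl fun j _ => ?_
    rw [inner_add_left]; ring
  have h6 : 96 * τ ^ 2 * s ^ 2 * ‖w‖ ^ 2 ≤ 96 * τ ^ 2 * s ^ 2 *
    ((∑ j, ‖b j‖ ^ 2) * ∑ j, inner ℝ y (b j) ^ 2) := by gcongr
  rw [h5, inner_smul_right, norm_smul, mul_pow, Real.norm_eq_abs, sq_abs]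
  nlinarith

end Vector
end NoisySystem

namespace NoisySystem

/-! ### Supermartingale argument along the trajectory -/

section Chain

variable {Ω : Type*} [MeasurableSpace Ω] {μ : Measure Ω} {d : ℕ}
  {f : EuclideanSpace ℝ (Fin d) → EuclideanSpace ℝ (Fin d)}

lemma trajectory_congr {e e' : ℕ → EuclideanSpace ℝ (Fin d)} {m : ℕ}
    (h : ∀ t < m, e t = e' t) : trajectory f e m = trajectory f e' m := by
  induction m with
  | zero => rfl
  | succ m ih =>
    simp only [trajectory]
    rw [ih fun t ht => h t (ht.trans m.lt_succ_self), h m m.lt_succ_self]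

lemma measurable_trajectory (hf : Measurable f) (m : ℕ) :
    Measurable fun e : ℕ → EuclideanSpace ℝ (Fin d) => trajectory f e m := by
  induction m with
  | zero => exact measurable_const
  | succ m ih => exact (hf.comp ih).add (measurable_pi_apply m)

variable [IsProbabilityMeasure μ] {n : ℕ} {ε : ℕ → Ω → EuclideanSpace ℝ (Fin d)}

omit [IsProbabilityMeasure μ] in
/-- Functionals of the first `m` noise vectors are independent of the next one. -/
lemma indepFun_comp_past (hm : ∀ t < n, Measurable (ε t))
    (hind : iIndepFun (fun t : Fin n => ε t) μ) {m : ℕ} (hmn : m < n) {β : Type*}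
    [MeasurableSpace β] {H : (ℕ → EuclideanSpace ℝ (Fin d)) → β} (hH : Measurable H)
    (hpast : ∀ e e' : ℕ → EuclideanSpace ℝ (Fin d), (∀ t < m, e t = e' t) → H e = H e') :
    IndepFun (fun ω => H fun t => ε t ω) (ε m) μ := by
  let S : Finset (Fin n) := Finset.univ.filter fun t => (t : ℕ) < m
  let T : Finset (Fin n) := {⟨m, hmn⟩}
  have hST : Disjoint S T := by simp [S, T]
  have h := hind.indepFun_finset S T hST fun t => hm t t.2
  -- Rebuilds a full sequence from the past, padded by zeros that `H` cannot see.
  let Φ : (S → EuclideanSpace ℝ (Fin d)) → ℕ → EuclideanSpace ℝ (Fin d) := fun y t =>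
    if ht : t < m then y ⟨⟨t, ht.trans hmn⟩, by simpa [S] using ht⟩ else 0
  have hΦ : Measurable Φ := by
    refine measurable_pi_lambda _ fun t => ?_
    by_cases ht : t < m
    · simp only [Φ, ht, dif_pos]; exact measurable_pi_apply _
    · simp only [Φ, ht]; exact measurable_const
  let ψ : (T → EuclideanSpace ℝ (Fin d)) → EuclideanSpace ℝ (Fin d) :=
    fun y => y ⟨⟨m, hmn⟩, by simp [T]⟩
  have hψ : Measurable ψ := measurable_pi_apply (_ : T)
  have h2 := h.comp (φ := H ∘ Φ) (ψ := ψ) (hH.comp hΦ) hψ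
  convert h2 using 1
  · ext ω
    refine hpast _ _ fun t ht => ?_
    simp [Φ, ht]
  · rfl

/-- Only the first `n` noise vectors are known to be measurable, so the sequence is truncated there.
-/
lemma measurable_extend_noise (hm : ∀ t < n, Measurable (ε t)) :
    Measurable fun ω (t : ℕ) => if t < n then ε t ω else 0 := by
  refine measurable_pi_lambda _ fun t => ?_
  by_cases ht : t < n
  · simpa [ht] using hm t ht
  · simp [ht]

/-- Conditionally sub-normalised factors along a trajectory have a product of mean at most one. -/
lemma lintegral_prod_trajectory_le_one (hm : ∀ t < n, Measurable (ε t))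
    (hind : iIndepFun (fun t : Fin n => ε t) μ) (hf : Measurable f)
    {g : EuclideanSpace ℝ (Fin d) → EuclideanSpace ℝ (Fin d) → ℝ≥0∞}
    (hg : Measurable (Function.uncurry g))
    (hle : ∀ t < n, ∀ x, ∫⁻ ω, g x (ε t ω) ∂μ ≤ 1) {m : ℕ} (hmn : m ≤ n) :
    ∫⁻ ω, ∏ t ∈ Finset.range m, g (trajectory f (fun t => ε t ω) t) (ε t ω) ∂μ ≤ 1 := by
  induction m with
  | zero => simp
  | succ m ih =>
    have hmn' : m < n := hmn
    let H : (ℕ → EuclideanSpace ℝ (Fin d)) → EuclideanSpace ℝ (Fin d) × ℝ≥0∞ := fun e =>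
      (trajectory f e m, ∏ t ∈ Finset.range m, g (trajectory f e t) (e t))
    have hH : Measurable H := by
      refine (measurable_trajectory hf m).prodMk (Finset.measurable_fun_prod _ fun t _ => ?_)
      exact hg.comp ((measurable_trajectory hf t).prodMk (measurable_pi_apply t))
    have hpast : ∀ e e' : ℕ → EuclideanSpace ℝ (Fin d), (∀ t < m, e t = e' t) → H e = H e' := by
      intro e e' h
      refine Prod.ext (trajectory_congr h) ?_
      change ∏ t ∈ Finset.range m, _ = ∏ t ∈ Finset.range m, _
      refine Finset.prod_congr rfl fun t ht => ?_
      have ht := Finset.mem_range.1 ht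
      rw [h t ht, trajectory_congr fun r hr => h r (hr.trans ht)]
    have hI := indepFun_comp_past hm hind hmn' hH hpast
    have hHm : Measurable fun ω => H fun t => ε t ω := by
      convert hH.comp (measurable_extend_noise hm) using 1
      ext1 ω
      refine hpast _ _ fun t ht => ?_
      simp [ht.trans hmn']
    have hεm := hm m hmn'
    have hG : Measurable fun q : (EuclideanSpace ℝ (Fin d) × ℝ≥0∞) × EuclideanSpace ℝ (Fin d) =>
        q.1.2 * g q.1.1 q.2 :=
      (measurable_snd.comp measurable_fst).mul
        (hg.comp ((measurable_fst.comp measurable_fst).prodMk measurable_snd))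
    have hgx : ∀ x, Measurable (g x) := fun x => hg.comp (measurable_const.prodMk measurable_id)
    calc ∫⁻ ω, ∏ t ∈ Finset.range (m + 1), g (trajectory f (fun t => ε t ω) t) (ε t ω) ∂μ
        = ∫⁻ q, q.1.2 * g q.1.1 q.2 ∂(μ.map fun ω => (H fun t => ε t ω, ε m ω)) := by
          rw [lintegral_map hG (hHm.prodMk hεm)]
          exact lintegral_congr fun ω => Finset.prod_range_succ _ _
      -- Independence turns the joint law into a product, so the fresh noise is integrated with the
      -- state frozen.
      _ = ∫⁻ h, ∫⁻ e, h.2 * g h.1 e ∂(μ.map (ε m)) ∂(μ.map fun ω => H fun t => ε t ω) := by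
          have : IsProbabilityMeasure (μ.map (ε m)) := Measure.isProbabilityMeasure_map
            hεm.aemeasurable
          rw [(indepFun_iff_map_prod_eq_prod_map_map hHm.aemeasurable hεm.aemeasurable).1 hI,
            lintegral_prod _ hG.aemeasurable]
      _ ≤ ∫⁻ h, h.2 ∂(μ.map fun ω => H fun t => ε t ω) := by
          refine lintegral_mono fun h => ?_
          rw [lintegral_const_mul _ (hgx _), lintegral_map (hgx _) hεm]
          exact mul_le_of_le_one_right' (hle m hmn' _)
      _ = ∫⁻ ω, ∏ t ∈ Finset.range m, g (trajectory f (fun t => ε t ω) t) (ε t ω) ∂μ := by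
          rw [lintegral_map measurable_snd hHm]
      _ ≤ 1 := ih hmn'.le

/-- Exponential Markov inequality for an additive functional along the trajectory. -/
lemma measure_le_sum_trajectory_le (hm : ∀ t < n, Measurable (ε t))
    (hind : iIndepFun (fun t : Fin n => ε t) μ) (hf : Measurable f)
    {G : EuclideanSpace ℝ (Fin d) → EuclideanSpace ℝ (Fin d) → ℝ}
    (hG : Measurable (Function.uncurry G))
    (hle : ∀ t < n, ∀ x, ∫⁻ ω, ENNReal.ofReal (Real.exp (G x (ε t ω))) ∂μ ≤ 1) (L : ℝ) :
    μ {ω | L ≤ ∑ t ∈ Finset.range n, G (trajectory f (fun t => ε t ω) t) (ε t ω)} ≤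
      ENNReal.ofReal (Real.exp (-L)) := by
  have h1 := lintegral_prod_trajectory_le_one hm hind hf
    (g := fun x e => ENNReal.ofReal (Real.exp (G x e)))
    (Real.measurable_exp.comp hG).ennreal_ofReal hle le_rfl
  have h2 : ∀ ω, ∏ t ∈ Finset.range n,
      ENNReal.ofReal (Real.exp (G (trajectory f (fun t => ε t ω) t) (ε t ω))) =
      ENNReal.ofReal (Real.exp (∑ t ∈ Finset.range n,
        G (trajectory f (fun t => ε t ω) t) (ε t ω))) := by
    intro ω
    rw [Real.exp_sum, ENNReal.ofReal_prod_of_nonneg fun t _ => (Real.exp_pos _).le]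
  simp_rw [h2] at h1
  have hSm : Measurable fun ω => ∑ t ∈ Finset.range n,
      G (trajectory f (fun t => ε t ω) t) (ε t ω) := by
    refine Finset.measurable_fun_sum _ fun t ht => ?_
    have ht := Finset.mem_range.1 ht
    refine hG.comp (Measurable.prodMk ?_ (hm t ht))
    convert (measurable_trajectory hf t).comp (measurable_extend_noise hm) using 1
    ext1 ω
    exact trajectory_congr fun r hr => by simp [hr.trans ht]
  have h3 := mul_meas_ge_le_lintegral (μ := μ) (Real.measurable_exp.comp hSm).ennreal_ofReal
    (ENNReal.ofReal (Real.exp L))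
  calc μ {ω | L ≤ ∑ t ∈ Finset.range n, G (trajectory f (fun t => ε t ω) t) (ε t ω)}
      = ENNReal.ofReal (Real.exp (-L)) * (ENNReal.ofReal (Real.exp L) *
        μ {ω | ENNReal.ofReal (Real.exp L) ≤ ENNReal.ofReal (Real.exp (∑ t ∈ Finset.range n,
          G (trajectory f (fun t => ε t ω) t) (ε t ω)))}) := by
        rw [← mul_assoc, ← ENNReal.ofReal_mul (Real.exp_pos _).le, ← Real.exp_add]
        simp [ENNReal.ofReal_le_ofReal_iff (Real.exp_pos _).le]
    _ ≤ ENNReal.ofReal (Real.exp (-L)) * 1 := by gcongr; exact h3.trans h1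
    _ = _ := mul_one _

end Chain
end NoisySystem

namespace NoisySystem

/-! ### Quadratic forms and the empirical covariance -/

section Quadratic

variable {d : ℕ}

lemma inner_eq_dotProduct (x y : EuclideanSpace ℝ (Fin d)) : inner ℝ x y = x.ofLp ⬝ᵥ y.ofLp := by
  rw [EuclideanSpace.inner_eq_star_dotProduct, dotProduct_comm]
  rfl

lemma norm_sq_eq_dotProduct (x : EuclideanSpace ℝ (Fin d)) : ‖x‖ ^ 2 = x.ofLp ⬝ᵥ x.ofLp := by
  rw [← real_inner_self_eq_norm_sq, inner_eq_dotProduct]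

lemma normK_sq {K : Matrix (Fin d) (Fin d) ℝ} (hK : K.PosSemidef) (x : EuclideanSpace ℝ (Fin d)) :
    normK K x ^ 2 = x.ofLp ⬝ᵥ (K *ᵥ x.ofLp) :=
  Real.sq_sqrt (by simpa using hK.dotProduct_mulVec_nonneg x.ofLp)

/-- A positive semidefinite quadratic form is a sum of squares of linear functionals. -/
lemma exists_normK_sq_eq_sum {K : Matrix (Fin d) (Fin d) ℝ} (hK : K.PosSemidef) :
    ∃ b : Fin d → EuclideanSpace ℝ (Fin d), (∀ x, normK K x ^ 2 = ∑ j, inner ℝ x (b j) ^ 2) ∧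
      K.trace = ∑ j, ‖b j‖ ^ 2 := by
  obtain ⟨B, hB⟩ := CStarAlgebra.nonneg_iff_eq_star_mul_self.1 hK.nonneg
  rw [Matrix.star_eq_conjTranspose, Matrix.conjTranspose_eq_transpose_of_trivial] at hB
  refine ⟨fun j => WithLp.toLp 2 (B j), fun x => ?_, ?_⟩
  · rw [normK_sq hK, hB, ← Matrix.mulVec_mulVec, Matrix.dotProduct_mulVec, Matrix.vecMul_transpose]
    refine Finset.sum_congr rfl fun j _ => ?_
    rw [inner_eq_dotProduct, dotProduct_comm x.ofLp, sq]
    rfl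
  · rw [hB, Matrix.trace_mul_comm]
    refine Finset.sum_congr rfl fun j _ => ?_
    rw [norm_sq_eq_dotProduct]
    rfl

lemma norm_sq_le_normK_sq {K : Matrix (Fin d) (Fin d) ℝ} (hK : K.PosSemidef) (h1 : 1 ≤ K)
    (x : EuclideanSpace ℝ (Fin d)) : ‖x‖ ^ 2 ≤ normK K x ^ 2 := by
  have h := (Matrix.le_iff.1 h1).dotProduct_mulVec_nonneg x.ofLp
  rw [Matrix.sub_mulVec, dotProduct_sub, Matrix.one_mulVec, star_trivial] at h
  rw [normK_sq hK, norm_sq_eq_dotProduct]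
  linarith

lemma natCast_le_trace {K : Matrix (Fin d) (Fin d) ℝ} (h1 : 1 ≤ K) : (d : ℝ) ≤ K.trace := by
  have h := (Matrix.le_iff.1 h1).trace_nonneg
  rw [Matrix.trace_sub, Matrix.trace_one, Fintype.card_fin] at h
  linarith

lemma dotProduct_empiricalCov_mulVec (n : ℕ) (x : ℕ → EuclideanSpace ℝ (Fin d))
    (θ : Fin d → ℝ) :
    θ ⬝ᵥ (empiricalCov n x *ᵥ θ) =
      (1 / (n : ℝ)) * ∑ i ∈ Finset.Icc 1 n, inner ℝ (x i) (WithLp.toLp 2 θ) ^ 2 := by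
  unfold empiricalCov
  rw [Matrix.smul_mulVec, dotProduct_smul, smul_eq_mul, Matrix.sum_mulVec, dotProduct_sum]
  congr 1
  refine Finset.sum_congr rfl fun i _ => ?_
  rw [Matrix.vecMulVec_mulVec, inner_eq_dotProduct, dotProduct_smul, dotProduct_comm θ]
  simp [sq]

lemma isHermitian_empiricalCov (n : ℕ) (x : ℕ → EuclideanSpace ℝ (Fin d)) :
    (empiricalCov n x).IsHermitian := by
  unfold empiricalCov
  refine Matrix.IsHermitian.ext fun i j => ?_
  simp [Matrix.sum_apply, Matrix.vecMulVec_apply, mul_comm]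

lemma smul_one_le_empiricalCov {n : ℕ} (hn : 1 ≤ n) {x : ℕ → EuclideanSpace ℝ (Fin d)} {c : ℝ}
    (h : ∀ θ : EuclideanSpace ℝ (Fin d), ‖θ‖ = 1 →
      n * c ≤ ∑ i ∈ Finset.Icc 1 n, inner ℝ (x i) θ ^ 2) :
    c • (1 : Matrix (Fin d) (Fin d) ℝ) ≤ empiricalCov n x := by
  have hn' : (0 : ℝ) < n := by exact_mod_cast hn
  rw [Matrix.le_iff]
  refine .of_dotProduct_mulVec_nonneg ((isHermitian_empiricalCov n x).sub ?_) fun θ => ?_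
  · exact Matrix.isHermitian_one.smul (by simp [IsSelfAdjoint])
  rw [star_trivial, Matrix.sub_mulVec, dotProduct_sub, dotProduct_empiricalCov_mulVec,
    Matrix.smul_mulVec, Matrix.one_mulVec, dotProduct_smul, smul_eq_mul]
  set v : EuclideanSpace ℝ (Fin d) := WithLp.toLp 2 θ with hv
  rw [show θ ⬝ᵥ θ = ‖v‖ ^ 2 from (norm_sq_eq_dotProduct v).symm]
  rcases eq_or_ne v 0 with h0 | h0
  · simp [h0]
  have hv0 := norm_ne_zero_iff.2 h0
  have h1 := h (‖v‖⁻¹ • v) (norm_smul_inv_norm h0)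
  simp_rw [inner_smul_right, mul_pow, ← Finset.mul_sum] at h1
  set S := ∑ i ∈ Finset.Icc 1 n, inner ℝ (x i) v ^ 2
  have h2 : ‖v‖ ^ 2 * (n * c) ≤ S := by
    calc ‖v‖ ^ 2 * (n * c) ≤ ‖v‖ ^ 2 * (‖v‖⁻¹ ^ 2 * S) := by gcongr
      _ = S := by field_simp
  have h3 : 1 / (n : ℝ) * (‖v‖ ^ 2 * (n * c)) ≤ 1 / (n : ℝ) * S := by gcongr
  have h4 : 1 / (n : ℝ) * (‖v‖ ^ 2 * (n * c)) = c * ‖v‖ ^ 2 := by field_simp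
  linarith

/-- The largest eigenvalue is at most the trace, so no net is needed for the upper bound. -/
lemma empiricalCov_le_smul_one {n : ℕ} (hn : 1 ≤ n) {x : ℕ → EuclideanSpace ℝ (Fin d)} {c : ℝ}
    (h : ∑ i ∈ Finset.Icc 1 n, ‖x i‖ ^ 2 ≤ n * c) :
    empiricalCov n x ≤ c • (1 : Matrix (Fin d) (Fin d) ℝ) := by
  have hn' : (0 : ℝ) < n := by exact_mod_cast hn
  rw [Matrix.le_iff]
  refine .of_dotProduct_mulVec_nonneg
    (Matrix.IsHermitian.sub ?_ (isHermitian_empiricalCov n x)) fun θ => ?_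
  · exact Matrix.isHermitian_one.smul (by simp [IsSelfAdjoint])
  rw [star_trivial, Matrix.sub_mulVec, dotProduct_sub, dotProduct_empiricalCov_mulVec,
    Matrix.smul_mulVec, Matrix.one_mulVec, dotProduct_smul, smul_eq_mul]
  set v : EuclideanSpace ℝ (Fin d) := WithLp.toLp 2 θ with hv
  rw [show θ ⬝ᵥ θ = ‖v‖ ^ 2 from (norm_sq_eq_dotProduct v).symm]
  have h2 : ∑ i ∈ Finset.Icc 1 n, inner ℝ (x i) v ^ 2 ≤ (n * c) * ‖v‖ ^ 2 := by
    refine le_trans ?_ (mul_le_mul_of_nonneg_right h (sq_nonneg ‖v‖))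
    rw [Finset.sum_mul]
    refine Finset.sum_le_sum fun i _ => ?_
    rw [← mul_pow, sq_le_sq, abs_mul, abs_norm, abs_norm]
    exact abs_real_inner_le_norm _ _
  have h3 : 1 / (n : ℝ) * (∑ i ∈ Finset.Icc 1 n, inner ℝ (x i) v ^ 2) ≤
    1 / (n : ℝ) * ((n * c) * ‖v‖ ^ 2) := by gcongr
  have h4 : 1 / (n : ℝ) * ((n * c) * ‖v‖ ^ 2) = c * ‖v‖ ^ 2 := by field_simp
  linarith

lemma sum_Icc_one_eq_sum_range (F : ℕ → ℝ) (n : ℕ) :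
    ∑ i ∈ Finset.Icc 1 n, F i = ∑ t ∈ Finset.range n, F (t + 1) := by
  induction n with
  | zero => simp
  | succ n ih => rw [Finset.sum_Icc_succ_top (by omega), ih, Finset.sum_range_succ]

end Quadratic

/-! ### Discretising the sphere -/

section Grid

variable {d : ℕ}

/-- The points of `m⁻¹ ℤᵈ` in the cube `[-1, 1]ᵈ`. -/
noncomputable def gridPoint (d m : ℕ) (k : Fin d → Fin (2 * m + 1)) : EuclideanSpace ℝ (Fin d) :=
  WithLp.toLp 2 fun j => ((k j : ℕ) - m : ℝ) / m

lemma exists_norm_sub_gridPoint_sq_le {m : ℕ} (hm : 0 < m) {θ : EuclideanSpace ℝ (Fin d)}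
    (hθ : ‖θ‖ = 1) : ∃ k, ‖gridPoint d m k - θ‖ ^ 2 ≤ d / (m : ℝ) ^ 2 := by
  have hm' : (0 : ℝ) < m := by exact_mod_cast hm
  have hb : ∀ j, -1 ≤ θ j ∧ θ j ≤ 1 := by
    intro j
    have h := PiLp.norm_apply_le θ j
    rw [hθ, Real.norm_eq_abs] at h
    exact abs_le.1 h
  have hk : ∀ j, ∃ k : Fin (2 * m + 1), (((k : ℕ) - m : ℝ) / m - θ j) ^ 2 ≤ 1 / (m : ℝ) ^ 2 := by
    intro j
    have h0 : 0 ≤ (θ j + 1) * m := mul_nonneg (by linarith [(hb j).1]) hm'.le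
    have h1 : ⌊(θ j + 1) * m⌋₊ ≤ 2 * m := by
      refine Nat.floor_le_of_le ?_
      push_cast
      have := (hb j).2
      gcongr
      linarith
    refine ⟨⟨⌊(θ j + 1) * m⌋₊, by omega⟩, ?_⟩
    have h2 := Nat.floor_le h0
    have h3 := Nat.lt_floor_add_one ((θ j + 1) * m)
    have h4 : ((⌊(θ j + 1) * m⌋₊ : ℝ) - m) / m - θ j =
        ((⌊(θ j + 1) * m⌋₊ : ℝ) - (θ j + 1) * m) / m := by
      field_simp; ring
    simp only [h4, div_pow]
    gcongr
    nlinarith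
  choose k hk using hk
  refine ⟨k, ?_⟩
  rw [EuclideanSpace.real_norm_sq_eq]
  calc ∑ j, (gridPoint d m k - θ) j ^ 2 ≤ ∑ _j : Fin d, 1 / (m : ℝ) ^ 2 :=
        Finset.sum_le_sum fun j _ => by simpa [gridPoint] using hk j
    _ = _ := by simp [div_eq_mul_inv]

/-- Passing from a grid to the whole sphere: a lower bound on the grid and an upper bound on the
total energy give a lower bound in every direction. -/
lemma quarter_le_sum_inner_sq {n m : ℕ} {x : ℕ → EuclideanSpace ℝ (Fin d)} {R : ℝ} (hR : 1 ≤ R)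
    (hd : d ≤ R) (hm : 20 * R ≤ m) (hup : ∑ i ∈ Finset.Icc 1 n, ‖x i‖ ^ 2 ≤ n * (4 * R))
    (hlow : ∀ k, ‖gridPoint d m k‖ ^ 2 * (n / 2) ≤
      ∑ i ∈ Finset.Icc 1 n, inner ℝ (x i) (gridPoint d m k) ^ 2)
    {θ : EuclideanSpace ℝ (Fin d)} (hθ : ‖θ‖ = 1) :
    n * (1 / 4 : ℝ) ≤ ∑ i ∈ Finset.Icc 1 n, inner ℝ (x i) θ ^ 2 := by
  have hm0 : (0 : ℝ) < m := by linarith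
  obtain ⟨k, hk⟩ := exists_norm_sub_gridPoint_sq_le (by exact_mod_cast hm0) hθ
  set v := gridPoint d m k
  set η := ‖v - θ‖ with hη
  have hη0 : 0 ≤ η := norm_nonneg _
  -- With `d ≤ R` and mesh at most `1/(20R)`, the squared error is at most `1/(400R)`, small against
  -- the energy `4R`.
  have h1 : η ^ 2 * R ≤ 1 / 400 := by
    have : η ^ 2 ≤ R / (20 * R) ^ 2 := hk.trans (by gcongr)
    calc η ^ 2 * R ≤ R / (20 * R) ^ 2 * R := by gcongr
      _ = 1 / 400 := by field_simp; norm_num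
  have h2 : η ≤ 1 / 20 := by nlinarith
  have h3 : 19 / 20 ≤ ‖v‖ := by
    have := norm_sub_norm_le θ v
    rw [hθ, norm_sub_rev, ← hη] at this
    linarith
  have h4 : ∑ i ∈ Finset.Icc 1 n, inner ℝ (x i) v ^ 2 ≤
      3 / 2 * ∑ i ∈ Finset.Icc 1 n, inner ℝ (x i) θ ^ 2 + 3 * (η ^ 2 * (n * (4 * R))) := by
    calc ∑ i ∈ Finset.Icc 1 n, inner ℝ (x i) v ^ 2
        ≤ ∑ i ∈ Finset.Icc 1 n, (3 / 2 * inner ℝ (x i) θ ^ 2 + 3 * (η ^ 2 * ‖x i‖ ^ 2)) := by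
          refine Finset.sum_le_sum fun i _ => ?_
          have h5 : inner ℝ (x i) v = inner ℝ (x i) θ + inner ℝ (x i) (v - θ) := by
            rw [← inner_add_right]; congr 1; abel
          have h6 : inner ℝ (x i) (v - θ) ^ 2 ≤ η ^ 2 * ‖x i‖ ^ 2 := by
            rw [← mul_pow, sq_le_sq, abs_mul, abs_of_nonneg hη0, abs_norm, mul_comm]
            exact abs_real_inner_le_norm _ _
          rw [h5]
          nlinarith [sq_nonneg (inner ℝ (x i) θ - 2 * inner ℝ (x i) (v - θ))]
      _ = 3 / 2 * ∑ i ∈ Finset.Icc 1 n, inner ℝ (x i) θ ^ 2 +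
          3 * (η ^ 2 * ∑ i ∈ Finset.Icc 1 n, ‖x i‖ ^ 2) := by
          rw [Finset.sum_add_distrib, Finset.mul_sum, Finset.mul_sum, Finset.mul_sum]
      _ ≤ _ := by gcongr
  have h5 := hlow k
  change ‖v‖ ^ 2 * (n / 2) ≤ ∑ i ∈ Finset.Icc 1 n, inner ℝ (x i) v ^ 2 at h5
  have h6 : (19 / 20 : ℝ) ^ 2 * (n / 2) ≤ ‖v‖ ^ 2 * (n / 2) := by gcongr
  have h7 : (n : ℝ) * (η ^ 2 * R) ≤ n * (1 / 400) := by gcongr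
  nlinarith

end Grid
end NoisySystem

/-! ### Deterministic energy summation and logarithmic bookkeeping -/

namespace NoisySystem

/-- Summing a contractive energy inequality. -/
lemma sum_energy_le {n : ℕ} {V W : ℕ → ℝ} {ρ s κ T L : ℝ} (hV0 : V 0 = 0) (hV : ∀ t, 0 ≤ V t)
    (hW : ∀ t, W t ≤ ρ * V t) (hρ0 : 0 ≤ ρ) (hρ1 : ρ < 1) (hs : 0 < s) (hκ0 : 0 ≤ κ)
    (hκ : κ ≤ s * (1 - ρ) / 48) (hT : 0 ≤ T)
    (h : ∑ t ∈ Finset.range n, (s * V (t + 1) - (s + κ) * W t - 3 / 2 * s * T) ≤ L)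
    (hL : L ≤ s * (n * T / 2)) :
    ∑ t ∈ Finset.range n, V (t + 1) ≤ n * (4 * (T / (1 - ρ))) := by
  have h1ρ : 0 < 1 - ρ := by linarith
  set A := ∑ t ∈ Finset.range n, V (t + 1) with hA
  have hA0 : 0 ≤ A := Finset.sum_nonneg fun t _ => hV _
  -- Shifting the index costs nothing because `V 0 = 0` and the new last term is nonnegative.
  have h1 : ∑ t ∈ Finset.range n, V t ≤ A := by
    have h2 := Finset.sum_range_succ V n
    rw [Finset.sum_range_succ' V n, hV0] at h2
    linarith [hV n]
  have h3 : ∑ t ∈ Finset.range n, W t ≤ ρ * A := by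
    refine (Finset.sum_le_sum fun t _ => hW t).trans ?_
    rw [← Finset.mul_sum]
    gcongr
  rw [Finset.sum_sub_distrib, Finset.sum_sub_distrib, ← Finset.mul_sum, ← Finset.mul_sum,
    Finset.sum_const, Finset.card_range, nsmul_eq_mul, ← hA] at h
  have h4 : (s + κ) * ∑ t ∈ Finset.range n, W t ≤ (s + κ) * (ρ * A) := by gcongr
  have h5 : κ * (ρ * A) ≤ s * (1 - ρ) / 48 * A := by
    calc κ * (ρ * A) ≤ s * (1 - ρ) / 48 * (1 * A) := by gcongr
      _ = _ := by ring
  have h6 : s * ((1 - ρ) * A * (47 / 48)) ≤ s * (2 * (n * T)) := by nlinarith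
  have h7 := le_of_mul_le_mul_left h6 hs
  have h8 : 0 ≤ n * T := by positivity
  rw [show (n : ℝ) * (4 * (T / (1 - ρ))) = 4 * (n * T) / (1 - ρ) by ring, le_div_iff₀ h1ρ]
  linarith

lemma two_div_le_sq {R δ : ℝ} (hR : 1 ≤ R) (hδ : 0 < δ) : 2 / δ ≤ (R / δ + 1) ^ 2 := by
  have h1 : 1 / δ ≤ R / δ := by gcongr
  have h2 : 0 < 1 / δ := by positivity
  rw [show 2 / δ = 2 * (1 / δ) by ring]
  nlinarith [sq_nonneg (R / δ)]

/-- The logarithmic term absorbs the cardinality of the grid and the failure probability. -/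
lemma grid_card_mul_exp_le {d m : ℕ} (hd : 1 ≤ d) {R δ a : ℝ} (hR : 1 ≤ R) (hδ : 0 < δ)
    (hδ1 : δ < 1) (hm : m ≤ 20 * R + 1) (ha : 9 * d * Real.log (R / δ + 1) ≤ a) :
    ((2 * m + 1 : ℕ) : ℝ) ^ d * Real.exp (-a) ≤ δ / 2 := by
  set z := R / δ + 1 with hz
  have hRz : R ≤ z - 1 := by
    rw [hz, add_sub_cancel_right, le_div_iff₀ hδ]; nlinarith
  have hz2 : 2 ≤ z := by linarith
  have hz0 : 0 < z := by linarith
  -- Here `2m + 1 ≤ 40R + 3 ≤ 2⁶ z` and `z ≥ 2`; the exponent 9 is 7 for the grid plus 2 for `2/δ`.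
  have h1 : ((2 * m + 1 : ℕ) : ℝ) ≤ z ^ 7 := by
    push_cast
    calc (2 * m + 1 : ℝ) ≤ 2 ^ 6 * z := by linarith
      _ ≤ z ^ 6 * z := by gcongr
      _ = z ^ 7 := by ring
  have h2 : 2 / δ ≤ z ^ (2 * d) :=
    (two_div_le_sq hR hδ).trans (pow_le_pow_right₀ (by linarith) (by omega))
  have h3 : z ^ (9 * d) ≤ Real.exp a := by
    calc z ^ (9 * d) = Real.exp (9 * d * Real.log z) := by
          rw [← Real.exp_log hz0, ← Real.exp_nat_mul, Real.exp_log hz0]; push_cast; rfl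
      _ ≤ _ := Real.exp_le_exp.2 ha
  have h4 : ((2 * m + 1 : ℕ) : ℝ) ^ d * (2 / δ) ≤ Real.exp a := by
    calc ((2 * m + 1 : ℕ) : ℝ) ^ d * (2 / δ) ≤ (z ^ 7) ^ d * z ^ (2 * d) := by gcongr
      _ = z ^ (9 * d) := by rw [← pow_mul, ← pow_add]; congr 1; ring
      _ ≤ _ := h3
  rw [Real.exp_neg, ← div_eq_mul_inv, div_le_iff₀ (Real.exp_pos a)]
  calc ((2 * m + 1 : ℕ) : ℝ) ^ d = δ / 2 * (((2 * m + 1 : ℕ) : ℝ) ^ d * (2 / δ)) := by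
        field_simp
    _ ≤ _ := by gcongr

/-! ### Tail bounds for the energy and for a fixed direction -/

section Events

variable {Ω : Type*} [MeasurableSpace Ω] {μ : Measure Ω} [IsProbabilityMeasure μ] {d n : ℕ}
  {f : EuclideanSpace ℝ (Fin d) → EuclideanSpace ℝ (Fin d)}
  {ε : ℕ → Ω → EuclideanSpace ℝ (Fin d)} {τ : ℝ}

lemma measure_energy_gt_le (hε : IsNoise n ε τ μ) (hf : Measurable f)
    {K : Matrix (Fin d) (Fin d) ℝ} {ρ : ℝ} (hges : IsGES K ρ f) (hK : 1 ≤ K) (hT : 0 < K.trace)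
    (hτ : 1 / 2 ≤ τ ^ 2) {L : ℝ} (hL : 18432 * τ ^ 4 * L ≤ n * (1 - ρ)) :
    μ {ω | ¬ ∑ i ∈ Finset.Icc 1 n, ‖trajectory f (fun t => ε t ω) i‖ ^ 2 ≤
      n * (4 * effectiveRadius K ρ)} ≤ ENNReal.ofReal (Real.exp (-L)) := by
  obtain ⟨b, hb, hbT⟩ := exists_normK_sq_eq_sum hges.posDef.posSemidef
  have h1ρ : 0 < 1 - ρ := by linarith [hges.rho_lt_one]
  have hτ4 : 0 < τ ^ 4 := by nlinarith
  have hτ0 : τ ≠ 0 := by rintro rfl; norm_num at hτ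
  set T := K.trace with hTdef
  -- Chosen so that the multiplicative excess `96 τ² s T` is at most `(1 - ρ)/48`, using `τ² ≥ 1/2`.
  set s := (1 - ρ) / (9216 * τ ^ 4 * T) with hs
  have hs0 : 0 < s := by positivity
  have hsT : s * T * (9216 * τ ^ 4) = 1 - ρ := by rw [hs]; field_simp
  have hstep : ∀ t < n, ∀ x, ∫⁻ ω, ENNReal.ofReal (Real.exp
      (s * (∑ j, inner ℝ (f x + ε t ω) (b j) ^ 2) -
      (s + 96 * τ ^ 2 * s ^ 2 * T) * (∑ j, inner ℝ (f x) (b j) ^ 2) - 3 / 2 * s * T)) ∂μ ≤ 1 := by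
    intro t ht x
    rw [hbT]
    exact lintegral_exp_quadratic_increment_le_one (hε.measurable t ht) (hε.isotropic t ht)
      (hε.subG t ht) b hs0.le (hbT ▸ hT) (by rw [← hbT, hsT]; linarith [hges.rho_nonneg]) (f x)
  refine le_trans (measure_mono fun ω hω => ?_)
    (measure_le_sum_trajectory_le (L := L) hε.measurable hε.indep hf
    (G := fun x e => s * (∑ j, inner ℝ (f x + e) (b j) ^ 2) -
      (s + 96 * τ ^ 2 * s ^ 2 * T) * (∑ j, inner ℝ (f x) (b j) ^ 2) - 3 / 2 * s * T)
    (by unfold Function.uncurry; fun_prop) hstep)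
  by_contra hlt
  refine hω ?_
  rw [Set.mem_ofPred_eq, not_le] at hlt
  set x := trajectory f (fun t => ε t ω)
  have hx1 : ∀ t, x (t + 1) = f (x t) + ε t ω := fun t => rfl
  simp_rw [← hx1, ← hb] at hlt
  have hκ : 96 * τ ^ 2 * s ^ 2 * T ≤ s * (1 - ρ) / 48 := by
    have h2 : 96 * τ ^ 2 * s ^ 2 * T = s * (96 * (τ ^ 2 * (s * T))) := by ring
    have h3 : 96 * (τ ^ 2 * (s * T)) ≤ (1 - ρ) / 48 := by
      have : τ ^ 2 * (s * T) * (1 / 2) ≤ τ ^ 2 * (s * T) * τ ^ 2 := by gcongr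
      nlinarith
    rw [h2, mul_div_assoc]
    gcongr
  have hmain := sum_energy_le (V := fun t => normK K (x t) ^ 2) (W := fun t => normK K (f (x t)) ^ 2)
    (n := n) (ρ := ρ) (s := s) (κ := 96 * τ ^ 2 * s ^ 2 * T) (T := T) (L := L)
    (by rw [hb]; simp [x, trajectory]) (fun t => sq_nonneg _) (fun t => hges.contract _)
    hges.rho_nonneg hges.rho_lt_one hs0 (by positivity) hκ hT.le hlt.le
    (by
      refine le_of_mul_le_mul_left ?_ (by positivity : 0 < 18432 * τ ^ 4)
      calc 18432 * τ ^ 4 * L ≤ n * (1 - ρ) := hL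
        _ = n * (s * T * (9216 * τ ^ 4)) := by rw [hsT]
        _ = _ := by ring)
  rw [sum_Icc_one_eq_sum_range]
  exact (Finset.sum_le_sum fun t _ =>
    norm_sq_le_normK_sq hges.posDef.posSemidef hK (x (t + 1))).trans hmain

/-- The drift is arbitrary here. Falling from the level `3/4` to `1/2` makes the exponent at least
`l n/4`. -/
lemma measure_directional_energy_lt_le (hε : IsNoise n ε τ μ) (hf : Measurable f)
    (hτ : τ ≠ 0) (v : EuclideanSpace ℝ (Fin d)) :
    μ {ω | ¬ ‖v‖ ^ 2 * (n / 2) ≤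
      ∑ i ∈ Finset.Icc 1 n, inner ℝ (trajectory f (fun t => ε t ω) i) v ^ 2} ≤
      ENNReal.ofReal (Real.exp (-(n / (768 * τ ^ 4)))) := by
  rcases eq_or_ne v 0 with rfl | hv
  · simp
  have hv0 : ‖v‖ ≠ 0 := norm_ne_zero_iff.2 hv
  set θ := ‖v‖⁻¹ • v with hθdef
  have hθ : ‖θ‖ = 1 := norm_smul_inv_norm hv
  have hτ4 : 0 < τ ^ 4 := by positivity
  set l := 1 / (192 * τ ^ 4) with hl
  have hl0 : 0 < l := by positivity
  refine le_trans (measure_mono fun ω hω => ?_)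
    (measure_le_sum_trajectory_le (L := n / (768 * τ ^ 4)) hε.measurable hε.indep hf
    (G := fun x e => -(l * (inner ℝ (f x + e) θ ^ 2 - 3 / 4)))
    (by unfold Function.uncurry; fun_prop)
    (fun t ht x => lintegral_exp_neg_sq_inner_add_le_one (hε.measurable t ht) (hε.isotropic t ht)
      (hε.subG t ht) hθ hl0.le (by rw [hl]; field_simp; rfl) (f x)))
  rw [Set.mem_ofPred_eq, not_le, sum_Icc_one_eq_sum_range] at hω
  rw [Set.mem_ofPred_eq]
  set x := trajectory f (fun t => ε t ω)
  have hx1 : ∀ t, x (t + 1) = f (x t) + ε t ω := fun t => rfl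
  simp_rw [← hx1]
  have h1 : ∑ t ∈ Finset.range n, inner ℝ (x (t + 1)) θ ^ 2 < n / 2 := by
    simp_rw [hθdef, inner_smul_right, mul_pow, ← Finset.mul_sum]
    rw [inv_pow, inv_mul_lt_iff₀ (by positivity)]
    exact hω
  rw [Finset.sum_neg_distrib, ← Finset.mul_sum, Finset.sum_sub_distrib, Finset.sum_const,
    Finset.card_range, nsmul_eq_mul]
  have h2 : n / (768 * τ ^ 4) = l * (n / 4) := by rw [hl]; field_simp; ring
  rw [h2, ← mul_neg]
  gcongr
  linarith

end Events
end NoisySystem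

/-! ### Main theorem -/

theorem theorem1 :
    ∃ c : ℝ, 0 < c ∧
      ∀ (d n : ℕ) (_ : 1 ≤ n)
        (K : Matrix (Fin d) (Fin d) ℝ) (ρ : ℝ)
        (f : EuclideanSpace ℝ (Fin d) → EuclideanSpace ℝ (Fin d))
        (_ : Measurable f) (_ : NoisySystem.IsGES K ρ f) (_ : 1 ≤ K)
        (Ω : Type*) (_ : MeasurableSpace Ω) (μ : Measure Ω) (_ : IsProbabilityMeasure μ)
        (ε : ℕ → Ω → EuclideanSpace ℝ (Fin d)) (τ : ℝ) (_ : NoisySystem.IsNoise n ε τ μ)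
        (δ : ℝ) (_ : 0 < δ)
        (_ : c * d * (τ ^ 4 / (1 - ρ) ^ 2) *
            Real.log (NoisySystem.effectiveRadius K ρ / δ + 1) ≤ n),
        ENNReal.ofReal (1 - δ) ≤
          μ {ω |
            (1 / 4 : ℝ) • (1 : Matrix (Fin d) (Fin d) ℝ) ≤
              NoisySystem.empiricalCov n (NoisySystem.trajectory f (fun t => ε t ω)) ∧
            NoisySystem.empiricalCov n (NoisySystem.trajectory f (fun t => ε t ω)) ≤
              (4 * NoisySystem.effectiveRadius K ρ) •
                (1 : Matrix (Fin d) (Fin d) ℝ)} := by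
  open NoisySystem in
  -- The energy bound requires `18432 · 2 = 36864`, the grid `768 · 9 = 6912`.
  refine ⟨40000, by norm_num, ?_⟩
  intro d n hn K ρ f hf hges hK Ω _ μ _ ε τ hε δ hδ hnd
  rcases le_or_gt 1 δ with hδ1 | hδ1
  · rw [ENNReal.ofReal_of_nonpos (by linarith)]
    exact zero_le
  -- Dimension zero is separate: it has no unit vector to force `τ² ≥ 1/2`, and `R ≥ 1` fails.
  rcases Nat.eq_zero_or_pos d with rfl | hd
  · have h : {ω | (1 / 4 : ℝ) • (1 : Matrix (Fin 0) (Fin 0) ℝ) ≤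
        empiricalCov n (trajectory f (fun t => ε t ω)) ∧
        empiricalCov n (trajectory f (fun t => ε t ω)) ≤
        (4 * effectiveRadius K ρ) • (1 : Matrix (Fin 0) (Fin 0) ℝ)} = Set.univ :=
      Set.eq_univ_of_forall fun ω => ⟨le_of_eq (Subsingleton.elim _ _),
        le_of_eq (Subsingleton.elim _ _)⟩
    rw [h, measure_univ, ENNReal.ofReal_le_one]
    linarith
  have hd' : (1 : ℝ) ≤ d := by exact_mod_cast hd
  have hstd := isStdSubG_inner (hε.measurable 0 hn) (hε.isotropic 0 hn) (hε.subG 0 hn)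
    (θ := EuclideanSpace.single ⟨0, hd⟩ 1) (by simp)
  have hτ := hstd.half_le_sq
  have hτ0 := hstd.ne_zero
  have hτ4 : 0 < τ ^ 4 := by positivity
  have hρ0 := hges.rho_nonneg
  have h1ρ : 0 < 1 - ρ := by linarith [hges.rho_lt_one]
  have hdT := natCast_le_trace hK
  have hT : 0 < K.trace := by linarith
  set R := effectiveRadius K ρ with hRdef
  have hdR : (d : ℝ) ≤ R := by
    rw [hRdef, effectiveRadius, le_div_iff₀ h1ρ]
    nlinarith
  have hR : 1 ≤ R := hd'.trans hdR
  set q := Real.log (R / δ + 1) with hq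
  have hq0 : 0 ≤ q := Real.log_nonneg (by have : 0 ≤ R / δ := by positivity
                                          linarith)
  have hn1 : 40000 * τ ^ 4 * (d * q) ≤ n * (1 - ρ) ^ 2 := by
    rw [show 40000 * d * (τ ^ 4 / (1 - ρ) ^ 2) * q =
      40000 * τ ^ 4 * (d * q) / (1 - ρ) ^ 2 by ring, div_le_iff₀ (by positivity)] at hnd
    exact hnd
  -- A single power of `1 - ρ` is enough from here on.
  have hn2 : 40000 * τ ^ 4 * (d * q) ≤ n * (1 - ρ) :=
    hn1.trans (by gcongr; nlinarith)
  have hn3 : 40000 * τ ^ 4 * (d * q) ≤ n :=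
    hn2.trans (mul_le_of_le_one_right (Nat.cast_nonneg n) (by linarith))
  have hqd : q ≤ d * q := le_mul_of_one_le_left hq0 hd'
  -- upper tail of the total energy
  have hup := measure_energy_gt_le hε hf hges hK hT hτ (L := Real.log (2 / δ)) (by
    have h1 : Real.log (2 / δ) ≤ 2 * q := by
      have := Real.log_le_log (by positivity) (two_div_le_sq hR hδ)
      rwa [Real.log_pow, Nat.cast_ofNat] at this
    have h2 : τ ^ 4 * Real.log (2 / δ) ≤ τ ^ 4 * (2 * (d * q)) := by gcongr; linarith
    have h3 : 0 ≤ τ ^ 4 * (d * q) := by positivity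
    nlinarith)
  rw [Real.exp_neg, Real.exp_log (by positivity), inv_div] at hup
  -- lower tails along the grid
  set m := ⌈20 * R⌉₊ with hm
  have hm1 : 20 * R ≤ m := Nat.le_ceil _
  have hm2 : (m : ℝ) ≤ 20 * R + 1 := (Nat.ceil_lt_add_one (by positivity)).le
  have hlow : μ (⋃ k, {ω | ¬ ‖gridPoint d m k‖ ^ 2 * (n / 2) ≤ ∑ i ∈ Finset.Icc 1 n,
      inner ℝ (trajectory f (fun t => ε t ω) i) (gridPoint d m k) ^ 2}) ≤
      ENNReal.ofReal (δ / 2) := by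
    refine (measure_iUnion_fintype_le _ _).trans ((Finset.sum_le_sum fun k _ =>
      measure_directional_energy_lt_le hε hf hτ0 (gridPoint d m k)).trans ?_)
    rw [Finset.sum_const, nsmul_eq_mul, ← ENNReal.ofReal_natCast, ← ENNReal.ofReal_mul (by positivity)]
    refine ENNReal.ofReal_le_ofReal ?_
    have h := grid_card_mul_exp_le hd hR hδ hδ1 hm2 (a := n / (768 * τ ^ 4)) (by
      rw [le_div_iff₀ (by positivity), ← hq]
      have h3 : 0 ≤ τ ^ 4 * (d * q) := by positivity
      nlinarith)
    simpa using h
  -- Stated as a covering of the whole space, so that subadditivity applies without measurability of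
  -- the good event.
  have hcover : (1 : ℝ≥0∞) ≤ μ {ω |
      (1 / 4 : ℝ) • (1 : Matrix (Fin d) (Fin d) ℝ) ≤
        empiricalCov n (trajectory f (fun t => ε t ω)) ∧
      empiricalCov n (trajectory f (fun t => ε t ω)) ≤
        (4 * R) • (1 : Matrix (Fin d) (Fin d) ℝ)} + ENNReal.ofReal δ := by
    rw [show δ = δ / 2 + δ / 2 by ring, ENNReal.ofReal_add (by positivity) (by positivity),
      ← measure_univ (μ := μ)]
    refine le_trans ?_ ((measure_union_le _ _).trans
      (add_le_add le_rfl ((measure_union_le _ _).trans (add_le_add hup hlow))))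
    refine measure_mono fun ω _ => ?_
    by_contra hω
    simp only [Set.mem_union, Set.mem_iUnion, Set.mem_ofPred_eq, not_or, not_exists, not_not] at hω
    obtain ⟨h1, h2, h3⟩ := hω
    exact h1 ⟨smul_one_le_empiricalCov hn fun θ hθ =>
      quarter_le_sum_inner_sq hR hdR hm1 h2 h3 hθ, empiricalCov_le_smul_one hn h2⟩
  rw [ENNReal.ofReal_sub _ hδ.le, ENNReal.ofReal_one, tsub_le_iff_right]
  exact hcover
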